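/- **Setting.** Consider a traffic network with finitely many links $a\in A$, origin–destination pairs $(o,d)$ with demands $q_{od}$, finite route sets $K_{od}$, link–route incidence $\delta_{a,k}^{od}\in\{0,1\}$, a parameter $\theta>0$, and link travel times $t_a(\omega,\xi)$ that depend on the link flow $\omega\ge 0$ and on an uncertain state $\xi\in\Xi$, where $\Xi\subseteq\mathbb R^m$ is closed; for every $\xi\in\Xi$, $t_a(\cdot,\xi)$ is nondecreasing on $[0,\infty)$. A route flow $f$ is feasible if $f_k^{od}\ge 0$ and $\sum_{k\in K_{od}}f_k^{od}=q_{od}$ for all $(o,d)$ and $k\in K_{od}$; its link flows are $x_a=\sum_{o,d}\sum_{k\in K_{od}} f_k^{od}\delta_{a,k}^{od}\ (\ge 0)$. The potential is $$Z(f,\xi)=\sum_{a\in A}\int_0^{x_a}t_a(\omega,\xi)\,d\omega+\frac1\theta\sum_{o,d}\sum_{k\in K_{od}}\Big[(f_k^{od}+1)\ln(f_k^{od}+1)-f_k^{od}\Big].$$ Assume that for every feasible $f$ the map $\xi\mapsto Z(f,\xi)$ is measurable and upper semicontinuous on $\Xi$ and has at most linear growth there: $|Z(f,\xi)|\le C_f(1+\|\xi\|_2)$.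 Let $0\le\lambda\le\alpha<1$, $\bar\lambda=\frac{\alpha-\lambda}{1+\alpha-2\lambda}$, $N\ge 1$, $\xi^1,\dots,\xi^N\in\Xi$, $P_0=\frac1N\sum_{i=1}^N\delta_{\xi^i}$, $\rho>0$, and let $\mathcal D$ be the set of probability measures $Q$ supported on $\Xi$ with $W_1(Q,P_0)\le\rho$, where $W_1$ is the $1$-Wasserstein distance for the Euclidean norm. Put $$\operatorname{CVaR}_{\alpha,Q}[Y]=\inf_{\gamma\in\mathbb R}\Big\{\gamma+\tfrac1{1-\alpha}\mathbb E_Q[(Y-\gamma)_+]\Big\},$$ $$\Phi^{\mathrm{DRO}}(f)=\sup_{Q\in\mathcal D}\Big\{(1-\bar\lambda)\,\mathbb E_Q[Z(f,\xi)]+\bar\lambda\operatorname{CVaR}_{\alpha,Q}[Z(f,\xi)]\Big\},$$ $$g_t(f,\xi)=(1-\bar\lambda)Z(f,\xi)+\tfrac{\bar\lambda}{1-\alpha}(Z(f,\xi)-t)_+ .$$ **Proposition.** 1. For every feasible $f$, $Z(f,\cdot)$ is integrable under every $Q\in\mathcal D$, and $$\Phi^{\mathrm{DRO}}(f)\le\inf_{t\in\mathbb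 R,\ \kappa\ge0}\Big\{\bar\lambda t+\kappa\rho+\frac1N\sum_{i=1}^N\sup_{\xi\in\Xi}\big(g_t(f,\xi)-\kappa\|\xi-\xi^i\|_2\big)\Big\}.$$ 2. Let $f$ be feasible and suppose that (i) $\sup_{Q\in\mathcal D}\inf_{t}\{\bar\lambda t+\mathbb E_Q[g_t(f,\xi)]\}=\inf_{t}\sup_{Q\in\mathcal D}\{\bar\lambda t+\mathbb E_Q[g_t(f,\xi)]\}$, and (ii) $\Xi$ is convex and, for every $t\in\mathbb R$, $g_t(f,\cdot)$ coincides on $\Xi$ with the maximum of finitely many functions $\ell_k:\mathbb R^m\to[-\infty,\infty)$ such that each $-\ell_k$ is proper, convex and lower semicontinuous and no $\ell_k$ is identically $-\infty$ on $\Xi$. Then the inequality in 1 is an equality, and $\Phi^{\mathrm{DRO}}(f)$ is also the infimum of $\bar\lambda t+\kappa\rho+\frac1N\sum_i s_i$ over all $(t,\kappa,s)\in\mathbb R\times[0,\infty)\times\mathbb R^N$ with $s_i\ge g_t(f,\xi)-\kappa\|\xi-\xi^i\|_2$ for all $\xi\in\Xi$ and all $i$. 3. The semi-infinite program $$\min_{f,t,\kappa,s}\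 \bar\lambda t+\kappa\rho+\frac1N\sum_{i=1}^N s_i\quad\text{s.t.}\quad s_i\ge g_t(f,\xi)-\kappa\|\xi-\xi^i\|_2\ \ (\xi\in\Xi,\ i=1,\dots,N),\quad \kappa\ge0,\ t\in\mathbb R,\ f\text{ feasible}$$ is convex: on the convex set of all $(f,t,\kappa,s)$ with $f$ feasible and $\kappa\ge0$, its objective and all its constraint functions $g_t(f,\xi)-\kappa\|\xi-\xi^i\|_2-s_i$ are convex, and hence its feasible set is convex. If (i) and (ii) hold for every feasible $f$, then it is an exact reformulation of $\min_f\{\Phi^{\mathrm{DRO}}(f): f\text{ feasible}\}$: the two problems have the same optimal value (infimum), and a route flow $f$ is an optimal solution of the latter if and only if there are $t,\kappa,s$ such that $(f,t,\kappa,s)$ is an optimal solution of the former. -/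

import Mathlib

open MeasureTheory Set
open scoped ENNReal

noncomputable section

/-! ### The traffic network and its potential -/

/-- Data of a traffic assignment model: `A` is the set of links, `W` the set of
origin-destination pairs, `K w` the set of routes of the pair `w`, and the uncertain network
state is a vector of `ℝ^m`. -/
structure TrafficNetwork (A W : Type*) (K : W → Type*) (m : ℕ) where
  /-- the links that a route uses -/
  links : ∀ w, K w → Set A
  /-- demand of an origin-destination pair -/
  demand : W → ℝ
  /-- travel time of a link as a function of the link flow and of the network state -/
  travelTime : A → ℝ → EuclideanSpace ℝ (Fin m) → ℝ
  /-- dispersion parameter of the route choice -/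
  θ : ℝ
  θ_pos : 0 < θ

namespace TrafficNetwork

variable {A W : Type*} {K : W → Type*} {m : ℕ}

/-- Link flow `x_a = ∑_{w} ∑_{k ∈ K w} f_k^w δ_{a,k}^w`, with `δ_{a,k}^w = 1` if the route `k`
uses the link `a` and `0` otherwise. -/
def linkFlow [Fintype W] [∀ w, Fintype (K w)] (net : TrafficNetwork A W K m)
    (f : ∀ w, K w → ℝ) (a : A) : ℝ :=
  ∑ w, ∑ k, f w k * (net.links w k).indicator 1 a

/-- Feasible route flows: demand conservation and nonnegativity of route and link flows. -/
def feasible [Fintype W] [∀ w, Fintype (K w)] (net : TrafficNetwork A W K m) :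
    Set (∀ w, K w → ℝ) :=
  {f | (∀ w, ∑ k, f w k = net.demand w) ∧ (∀ w k, 0 ≤ f w k) ∧ ∀ a, 0 ≤ net.linkFlow f a}

/-- The potential `Z(f, ξ)`: congestion (Beckmann) term plus entropy term. -/
def potential [Fintype A] [Fintype W] [∀ w, Fintype (K w)] (net : TrafficNetwork A W K m)
    (f : ∀ w, K w → ℝ) (ξ : EuclideanSpace ℝ (Fin m)) : ℝ :=
  ∑ a, (∫ ω in (0 : ℝ)..net.linkFlow f a, net.travelTime a ω ξ) +
    1 / net.θ * ∑ w, ∑ k, ((f w k + 1) * Real.log (f w k + 1) - f w k)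

end TrafficNetwork

/-! ### The normalized mean-CVaR certainty equivalent -/

/-- Effective mixing weight of the normalized mean-CVaR certainty equivalent. -/
def effWeight (α lam : ℝ) : ℝ := (α - lam) / (1 + α - 2 * lam)

/-- Conditional value at risk of the cost `Y` under `Q`. For integrable `Y` and `0 ≤ α < 1` the
infimum is over a set that is bounded below (by the mean of `Y`). -/
def cvar {E : Type*} [MeasurableSpace E] (α : ℝ) (Q : Measure E) (Y : E → ℝ) : ℝ :=
  ⨅ γ : ℝ, (γ + 1 / (1 - α) * ∫ x, max (Y x - γ) 0 ∂Q)

/-- The normalized mean-CVaR certainty equivalent of the cost `Y` under `Q`. -/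
def meanCVaR {E : Type*} [MeasurableSpace E] (α lam : ℝ) (Q : Measure E) (Y : E → ℝ) : ℝ :=
  (1 - effWeight α lam) * ∫ x, Y x ∂Q + effWeight α lam * cvar α Q Y

/-- The hinge-augmented payoff at the cost value `z` and threshold `t`. -/
def hingePayoff (α lam t z : ℝ) : ℝ :=
  (1 - effWeight α lam) * z + effWeight α lam / (1 - α) * max (z - t) 0

/-! ### The Wasserstein ambiguity set -/

/-- Couplings of `Q` and `P`. -/
def couplings {E : Type*} [MeasurableSpace E] (Q P : Measure E) : Set (Measure (E × E)) :=
  {π | π.map Prod.fst = Q ∧ π.map Prod.snd = P}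

/-- The `1`-Wasserstein distance, with the metric of `E` as transport cost. -/
def wasserstein1 {E : Type*} [MeasurableSpace E] [PseudoEMetricSpace E] (Q P : Measure E) :
    ℝ≥0∞ :=
  ⨅ π ∈ couplings Q P, ∫⁻ p, edist p.1 p.2 ∂π

/-- The empirical distribution of a sample. -/
def empirical {E : Type*} [MeasurableSpace E] {N : ℕ} (ξs : Fin N → E) : Measure E :=
  (N : ℝ≥0∞)⁻¹ • ∑ i, Measure.dirac (ξs i)

/-- The `1`-Wasserstein ball of radius `ρ` around `P` in the set of all probability
distributions that are supported on `Ξ`. -/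
def wassersteinBall {E : Type*} [MeasurableSpace E] [PseudoEMetricSpace E] (Ξ : Set E)
    (P : Measure E) (ρ : ℝ) : Set (Measure E) :=
  {Q | IsProbabilityMeasure Q ∧ Q Ξᶜ = 0 ∧ wasserstein1 Q P ≤ ENNReal.ofReal ρ}

/-- The piecewise-concavity condition: `Ξ` is closed and convex, and on `Ξ` the function `ℓ` is
the maximum of finitely many functions `ℓ₁, …, ℓ_n` from the whole space to the extended reals
such that `-ℓ_k` is proper, convex and lower semicontinuous and `ℓ_k` is not identically `-∞`
on `Ξ`. Concavity of the extended-valued `ℓ_k` is convexity of its hypograph. -/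
def PiecewiseConcaveOn {E : Type*} [AddCommGroup E] [Module ℝ E] [TopologicalSpace E]
    (Ξ : Set E) (ℓ : E → ℝ) : Prop :=
  IsClosed Ξ ∧ Convex ℝ Ξ ∧ ∃ (n : ℕ) (pieces : Fin n → E → EReal),
    (∀ k, (∀ ξ, pieces k ξ ≠ ⊤) ∧ (∃ ξ ∈ Ξ, pieces k ξ ≠ ⊥) ∧
      Convex ℝ {p : E × ℝ | (p.2 : EReal) ≤ pieces k p.1} ∧
      UpperSemicontinuous (pieces k)) ∧
    ∀ ξ ∈ Ξ, (ℓ ξ : EReal) = ⨆ k, pieces k ξ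

/-! ### The distributionally robust problem, its dual bound and the semi-infinite program -/

namespace TrafficNetwork

variable {A W : Type*} {K : W → Type*} {m : ℕ} [Fintype A] [Fintype W] [∀ w, Fintype (K w)]

/-- The worst-case normalized mean-CVaR objective over the ambiguity set `D`. -/
def droObjective (net : TrafficNetwork A W K m) (α lam : ℝ)
    (D : Set (Measure (EuclideanSpace ℝ (Fin m)))) (f : ∀ w, K w → ℝ) : EReal :=
  ⨆ Q ∈ D, ((meanCVaR α lam Q (net.potential f) : ℝ) : EReal)

/-- The hinge-augmented payoff `g_t(f, ξ)`. -/
def payoff (net : TrafficNetwork A W K m) (α lam t : ℝ) (f : ∀ w, K w → ℝ)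
    (ξ : EuclideanSpace ℝ (Fin m)) : ℝ :=
  hingePayoff α lam t (net.potential f ξ)

/-- The infimum over `t` and `κ ≥ 0` of
`λ̄ t + κ ρ + (1/N) ∑ i, sup_{ξ ∈ Ξ} (g_t(f, ξ) - κ ‖ξ - ξ^i‖)`, where the suprema are taken in
the extended reals. -/
def dualBound (net : TrafficNetwork A W K m) (α lam ρ : ℝ)
    (Ξ : Set (EuclideanSpace ℝ (Fin m))) {N : ℕ} (ξs : Fin N → EuclideanSpace ℝ (Fin m))
    (f : ∀ w, K w → ℝ) : EReal :=
  ⨅ (t : ℝ) (κ : ℝ) (_ : 0 ≤ κ),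
    ((effWeight α lam * t + κ * ρ : ℝ) : EReal) + ((1 / (N : ℝ) : ℝ) : EReal) *
      ∑ i, ⨆ ξ ∈ Ξ, ((net.payoff α lam t f ξ - κ * ‖ξ - ξs i‖ : ℝ) : EReal)

/-- The minimax interchange for the epigraph form `λ̄ t + E_Q[g_t(f, ξ)]` of the objective. -/
def MinimaxInterchange (net : TrafficNetwork A W K m) (α lam : ℝ)
    (D : Set (Measure (EuclideanSpace ℝ (Fin m)))) (f : ∀ w, K w → ℝ) : Prop :=
  (⨆ Q ∈ D, ⨅ t : ℝ, ((effWeight α lam * t + ∫ ξ, net.payoff α lam t f ξ ∂Q : ℝ) : EReal)) =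
    ⨅ t : ℝ, ⨆ Q ∈ D, ((effWeight α lam * t + ∫ ξ, net.payoff α lam t f ξ ∂Q : ℝ) : EReal)

/-- Objective `λ̄ t + κ ρ + (1/N) ∑ i, s_i` of the semi-infinite program, in the variables
`(f, t, κ, s)`. -/
def sipObjective (_net : TrafficNetwork A W K m) (α lam ρ : ℝ) {N : ℕ}
    (p : (∀ w, K w → ℝ) × ℝ × ℝ × (Fin N → ℝ)) : ℝ :=
  effWeight α lam * p.2.1 + p.2.2.1 * ρ + 1 / (N : ℝ) * ∑ i, p.2.2.2 i

/-- The set that carries the semi-infinite program: `f` is feasible and `κ ≥ 0`. -/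
def sipDomain (net : TrafficNetwork A W K m) (N : ℕ) :
    Set ((∀ w, K w → ℝ) × ℝ × ℝ × (Fin N → ℝ)) :=
  {p | p.1 ∈ net.feasible ∧ 0 ≤ p.2.2.1}

/-- The constraint function `g_t(f, ξ) - κ ‖ξ - ξ^i‖ - s_i` that belongs to `ξ` and `i`. -/
def sipConstraint (net : TrafficNetwork A W K m) (α lam : ℝ) {N : ℕ}
    (ξs : Fin N → EuclideanSpace ℝ (Fin m)) (ξ : EuclideanSpace ℝ (Fin m)) (i : Fin N)
    (p : (∀ w, K w → ℝ) × ℝ × ℝ × (Fin N → ℝ)) : ℝ :=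
  net.payoff α lam p.2.1 p.1 ξ - p.2.2.1 * ‖ξ - ξs i‖ - p.2.2.2 i

/-- Feasible set of the semi-infinite program. -/
def sipFeasible (net : TrafficNetwork A W K m) (α lam : ℝ)
    (Ξ : Set (EuclideanSpace ℝ (Fin m))) {N : ℕ} (ξs : Fin N → EuclideanSpace ℝ (Fin m)) :
    Set ((∀ w, K w → ℝ) × ℝ × ℝ × (Fin N → ℝ)) :=
  {p | p ∈ net.sipDomain N ∧ ∀ ξ ∈ Ξ, ∀ i, net.sipConstraint α lam ξs ξ i p ≤ 0}

end TrafficNetwork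

end

/-! For a fixed payoff `g`, weak duality comes from integrating `g ξ ≤ κ‖ξ - y‖ + h y` against a
nearly optimal coupling (`integral_le_of_mem_wassersteinBall`).

The converse needs no measurable selection. Mixing measures mixes their radii
(`wassersteinBall_mix`), so the worst-case expectation is concave in the radius and has a
supergradient `κ ≥ 0` at the interior point `ρ > 0` (`exists_supergradient`). Testing the
supergradient inequality on samples with displaced points, at radius equal to the mean displacement,
decouples into one supremum per sample point (`exists_dual_solution`).

The mean-CVaR functional is an infimum over thresholds `t` (`meanCVaR_eq_iInf`). The worst case as a
function of `t` is Lipschitz, and coercive when the weight is positive, so an optimal `t` exists.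
Hence under the minimax interchange each feasible `f` has a point `(t, κ, s)` attaining the robust
value, which transfers minimizers as well as infima.

Convexity of the program rests on two facts: the potential is convex in `f`, and the hinge payoff is
jointly convex and increasing in the cost. -/

/-! ### Empirical measures. -/

section Empirical

variable {E : Type*} [MeasurableSpace E] {N : ℕ} {ξs : Fin N → E}

theorem integral_empirical [MeasurableSingletonClass E] (h : E → ℝ) :
    ∫ ξ, h ξ ∂(empirical ξs) = 1 / (N : ℝ) * ∑ i, h (ξs i) := by
  rw [empirical, integral_smul_measure, integral_finsetSum_measure]
  · simp
  · intro i _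
    exact integrable_dirac (by simp)

theorem integrable_empirical [MeasurableSingletonClass E] (hN : 0 < N) (h : E → ℝ) :
    Integrable h (empirical ξs) := by
  refine Integrable.smul_measure ?_ (by simp [hN.ne'])
  rw [integrable_finsetSum_measure]
  intro i _
  exact integrable_dirac (by simp)

theorem isProbabilityMeasure_empirical (hN : 0 < N) :
    IsProbabilityMeasure (empirical ξs) := by
  refine ⟨?_⟩
  simp only [empirical, Measure.smul_apply, Measure.finsetSum_apply, measure_univ]
  simp [ENNReal.inv_mul_cancel, hN.ne']

theorem ae_empirical_iff [MeasurableSingletonClass E] (p : E → Prop) :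
    (∀ᵐ ξ ∂(empirical ξs), p ξ) ↔ ∀ i, p (ξs i) := by
  rw [empirical, Measure.ae_ennreal_smul_measure_iff (by simp),
    ae_iff, Measure.finsetSum_apply, Finset.sum_eq_zero_iff]
  refine ⟨fun h i => ?_, fun h i _ => ?_⟩
  · have := h i (Finset.mem_univ i)
    rw [← ae_iff, ae_dirac_eq] at this
    exact this
  · rw [← ae_iff, ae_dirac_eq]
    exact h i

theorem map_empirical {F : Type*} [MeasurableSpace F] {φ : E → F} (hφ : Measurable φ) :
    (empirical ξs).map φ = empirical (fun i => φ (ξs i)) := by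
  rw [empirical, empirical, Measure.map_smul, Measure.map_finset_sum hφ.aemeasurable]
  simp [Measure.map_dirac' hφ]

end Empirical

/-! ### Mixtures in Wasserstein balls. -/

section Mixture

variable {E : Type*} [MeasurableSpace E] [PseudoEMetricSpace E] {Ξ : Set E} {P : Measure E}

theorem ae_mem_of_mem_wassersteinBall {Q : Measure E} {r : ℝ}
    (hQ : Q ∈ wassersteinBall Ξ P r) :
    ∀ᵐ ξ ∂Q, ξ ∈ Ξ := hQ.2.1

/-- Mixing couplings of `Q₁` and `Q₂` with `P` gives a coupling of the mixture with `P`, and the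
transport cost is linear in the coupling. -/
theorem wassersteinBall_mix {Q₁ Q₂ : Measure E} [IsProbabilityMeasure P] {r₁ r₂ a b : ℝ}
    (h₁ : Q₁ ∈ wassersteinBall Ξ P r₁) (h₂ : Q₂ ∈ wassersteinBall Ξ P r₂)
    (hr₁ : 0 ≤ r₁) (hr₂ : 0 ≤ r₂)
    (ha : 0 < a) (hb : 0 < b) (hab : a + b = 1) :
    ENNReal.ofReal a • Q₁ + ENNReal.ofReal b • Q₂ ∈ wassersteinBall Ξ P (a * r₁ + b * r₂) := by
  have i₁ := h₁.1
  have i₂ := h₂.1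
  have hab' : ENNReal.ofReal a + ENNReal.ofReal b = 1 := by
    rw [← ENNReal.ofReal_add ha.le hb.le, hab, ENNReal.ofReal_one]
  refine ⟨⟨by simp [hab']⟩, by simp [h₁.2.1, h₂.2.1], ?_⟩
  have hle : wasserstein1 (ENNReal.ofReal a • Q₁ + ENNReal.ofReal b • Q₂) P ≤
      ENNReal.ofReal a * wasserstein1 Q₁ P + ENNReal.ofReal b * wasserstein1 Q₂ P := by
    -- In `ℝ≥0∞` a factor passes through the infimum because it is neither `0` nor `∞`.
    have hmul : ∀ (c : ℝ) (_ : 0 < c) (Q : Measure E), ENNReal.ofReal c * wasserstein1 Q P =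
        ⨅ π : couplings Q P, ENNReal.ofReal c * ∫⁻ p, edist p.1 p.2 ∂(π : Measure (E × E)) := by
      intro c hc Q
      rw [wasserstein1, iInf_subtype', ENNReal.mul_iInf_of_ne (by simpa using hc)
        ENNReal.ofReal_ne_top]
    rw [hmul a ha, hmul b hb, ENNReal.iInf_add]
    refine le_iInf fun π₁ => ?_
    rw [ENNReal.add_iInf]
    refine le_iInf fun π₂ => (iInf₂_le (ENNReal.ofReal a • (π₁ : Measure (E × E)) +
      ENNReal.ofReal b • (π₂ : Measure (E × E))) ⟨?_, ?_⟩).trans (le_of_eq ?_)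
    · rw [lintegral_add_measure, lintegral_smul_measure, lintegral_smul_measure, smul_eq_mul,
        smul_eq_mul]
    · rw [Measure.map_add _ _ measurable_fst, Measure.map_smul, Measure.map_smul, π₁.2.1, π₂.2.1]
    · rw [Measure.map_add _ _ measurable_snd, Measure.map_smul, Measure.map_smul, π₁.2.2, π₂.2.2,
        ← add_smul, hab', one_smul]
  refine hle.trans ?_
  rw [ENNReal.ofReal_add (by positivity) (by positivity), ENNReal.ofReal_mul ha.le,
    ENNReal.ofReal_mul hb.le]
  gcongr
  exacts [h₁.2.2, h₂.2.2]

end Mixture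

/-! ### Couplings, moments and weak duality. -/

section Wasserstein

variable {E : Type*} [NormedAddCommGroup E] [MeasurableSpace E] [BorelSpace E]
  [SecondCountableTopology E] {Ξ : Set E} {N : ℕ} {ξs : Fin N → E} {Q : Measure E} {r : ℝ}

/-- A nearly optimal coupling, together with the integrability of its transport cost. -/
theorem exists_coupling_of_mem_wassersteinBall {P : Measure E}
    (hQ : Q ∈ wassersteinBall Ξ P r) (hr : 0 ≤ r) {ε : ℝ} (hε : 0 < ε) :
    ∃ π ∈ couplings Q P, Integrable (fun p : E × E => ‖p.1 - p.2‖) π ∧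
      ∫ p, ‖p.1 - p.2‖ ∂π ≤ r + ε := by
  have h : wasserstein1 Q P < ENNReal.ofReal (r + ε) :=
    hQ.2.2.trans_lt ((ENNReal.ofReal_lt_ofReal_iff (by linarith)).2 (by linarith))
  simp only [wasserstein1, iInf_lt_iff] at h
  obtain ⟨π, hπ, hlt⟩ := h
  have heq : ∀ p : E × E, edist p.1 p.2 = ‖‖p.1 - p.2‖‖ₑ := fun p => by
    rw [edist_eq_enorm_sub, enorm_norm]
  simp only [heq] at hlt
  have hint : Integrable (fun p : E × E => ‖p.1 - p.2‖) π :=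
    ⟨(by fun_prop : Measurable fun p : E × E => ‖p.1 - p.2‖).aestronglyMeasurable,
      hlt.trans ENNReal.ofReal_lt_top⟩
  refine ⟨π, hπ, hint, ?_⟩
  rw [integral_eq_lintegral_of_nonneg_ae (ae_of_all _ fun _ => norm_nonneg _) hint.1]
  refine ENNReal.toReal_le_of_le_ofReal (by linarith) (le_trans (le_of_eq ?_) hlt.le)
  refine lintegral_congr fun p => ?_
  rw [Real.enorm_of_nonneg (norm_nonneg _)]

theorem integrable_norm_of_mem_wassersteinBall (hN : 0 < N)
    (hQ : Q ∈ wassersteinBall Ξ (empirical ξs) r) : Integrable (fun ξ : E => ‖ξ‖) Q := by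
  -- A negative radius acts as `0`, since `ENNReal.ofReal` truncates.
  have hQ' : Q ∈ wassersteinBall Ξ (empirical ξs) (max r 0) :=
    ⟨hQ.1, hQ.2.1, hQ.2.2.trans (ENNReal.ofReal_le_ofReal (le_max_left _ _))⟩
  obtain ⟨π, hπ, hint, -⟩ :=
    exists_coupling_of_mem_wassersteinBall hQ' (le_max_right _ _) one_pos
  have h2 : Integrable (fun p : E × E => ‖p.2‖) π := by
    have := integrable_empirical (ξs := ξs) hN (fun ξ : E => ‖ξ‖)
    rw [← hπ.2] at this
    exact this.comp_measurable measurable_snd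
  have h1 : Integrable (fun p : E × E => ‖p.1‖) π := by
    refine (hint.add h2).mono' (by fun_prop) (ae_of_all _ fun p => ?_)
    simpa using norm_le_norm_sub_add p.1 p.2
  rw [← hπ.1]
  exact (integrable_map_measure (by fun_prop) (by fun_prop)).2 h1

/-- `Q` is carried by the closed set `Ξ`, so measurability on `Ξ` suffices, and linear growth is
dominated by the finite first moment. -/
theorem integrable_of_mem_wassersteinBall (hΞ : IsClosed Ξ) (hN : 0 < N)
    (hQ : Q ∈ wassersteinBall Ξ (empirical ξs) r) {g : E → ℝ}
    (hg : Measurable (Ξ.domRestrict g)) {C : ℝ} (hC : ∀ ξ ∈ Ξ, |g ξ| ≤ C * (1 + ‖ξ‖)) :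
    Integrable g Q := by
  have := hQ.1
  have hmem := ae_mem_of_mem_wassersteinBall hQ
  have hm : AEMeasurable g Q := by
    rw [← Measure.restrict_eq_self_of_ae_mem hmem]
    exact aemeasurable_restrict_of_measurable_subtype hΞ.measurableSet hg
  refine Integrable.mono' (((integrable_const 1).add
    (integrable_norm_of_mem_wassersteinBall hN hQ)).const_mul C) hm.aestronglyMeasurable ?_
  filter_upwards [hmem] with ξ hξ
  exact hC ξ hξ

/-- Weak duality over the Wasserstein ball, with epigraph variables. -/
theorem integral_le_of_mem_wassersteinBall (hN : 0 < N) (hr : 0 ≤ r) (hξs : ∀ i, ξs i ∈ Ξ)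
    (hQ : Q ∈ wassersteinBall Ξ (empirical ξs) r) {g : E → ℝ} (hg : Integrable g Q)
    {κ : ℝ} (hκ : 0 ≤ κ) {s : Fin N → ℝ}
    (hs : ∀ ξ ∈ Ξ, ∀ i, g ξ - κ * ‖ξ - ξs i‖ ≤ s i) :
    ∫ ξ, g ξ ∂Q ≤ κ * r + 1 / (N : ℝ) * ∑ i, s i := by
  have : Nonempty Ξ := ⟨⟨_, hξs ⟨0, hN⟩⟩⟩
  -- `s` depends on the index, and sample points may coincide; `h` is a function of the point and
  -- can be integrated against the second marginal.
  set h : E → ℝ := fun y => ⨆ ξ : Ξ, (g ξ - κ * ‖(ξ : E) - y‖) with hh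
  have hle : ∀ i, h (ξs i) ≤ s i := fun i => ciSup_le fun ξ => hs ξ ξ.2 i
  have hge : ∀ i, ∀ ξ ∈ Ξ, g ξ - κ * ‖ξ - ξs i‖ ≤ h (ξs i) := fun i ξ hξ =>
    le_ciSup (f := fun ξ : Ξ => g ξ - κ * ‖(ξ : E) - ξs i‖)
      ⟨s i, by rintro _ ⟨ξ, rfl⟩; exact hs ξ ξ.2 i⟩ ⟨ξ, hξ⟩
  have key : ∀ ε > 0, ∫ ξ, g ξ ∂Q ≤ κ * (r + ε) + 1 / (N : ℝ) * ∑ i, s i := by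
    intro ε hε
    obtain ⟨π, hπ, hint, hcost⟩ := exists_coupling_of_mem_wassersteinBall hQ hr hε
    have hQ1 := hπ.1
    have hQ2 := hπ.2
    have hg1 : Integrable (fun p : E × E => g p.1) π := by
      rw [← hQ1] at hg
      exact hg.comp_measurable measurable_fst
    have hh0 := integrable_empirical (ξs := ξs) hN h
    rw [← hQ2] at hh0
    have hh2 : Integrable (fun p : E × E => h p.2) π := hh0.comp_measurable measurable_snd
    have e1 : ∫ ξ, g ξ ∂Q = ∫ p, g p.1 ∂π := by
      rw [← hQ1] at hg ⊢
      exact integral_map measurable_fst.aemeasurable hg.1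
    have e2 : ∫ p, h p.2 ∂π = 1 / (N : ℝ) * ∑ i, h (ξs i) := by
      rw [← integral_empirical, ← hQ2]
      exact (integral_map measurable_snd.aemeasurable hh0.1).symm
    have a1 : ∀ᵐ p ∂π, p.1 ∈ Ξ := by
      have := ae_mem_of_mem_wassersteinBall hQ
      rw [← hQ1] at this
      exact ae_of_ae_map measurable_fst.aemeasurable this
    have a2 : ∀ᵐ p ∂π, ∃ i, ξs i = p.2 := by
      have : ∀ᵐ y ∂(empirical ξs), ∃ i, ξs i = y := (ae_empirical_iff _).2 fun i => ⟨i, rfl⟩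
      rw [← hQ2] at this
      exact ae_of_ae_map measurable_snd.aemeasurable this
    have hmono : ∫ p, g p.1 ∂π ≤ ∫ p, (κ * ‖p.1 - p.2‖ + h p.2) ∂π := by
      refine integral_mono_ae hg1 ((hint.const_mul κ).add hh2) ?_
      filter_upwards [a1, a2] with p h1 h2
      obtain ⟨i, hi⟩ := h2
      have := hge i p.1 h1
      rw [hi] at this
      linarith
    rw [integral_add (hint.const_mul κ) hh2, integral_const_mul, e2] at hmono
    rw [e1]
    refine hmono.trans (add_le_add (mul_le_mul_of_nonneg_left hcost hκ) ?_)
    exact mul_le_mul_of_nonneg_left (Finset.sum_le_sum fun i _ => hle i) (by positivity)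
  refine le_of_forall_pos_le_add fun ε hε => ?_
  -- The `+ 1` covers `κ = 0`.
  have h1 := key (ε / (κ + 1)) (by positivity)
  have h2 : κ * (ε / (κ + 1)) ≤ ε := by
    rw [mul_div_assoc', div_le_iff₀ (by positivity)]
    nlinarith
  linarith

/-- The empirical distribution of a perturbed sample. -/
theorem empirical_mem_wassersteinBall (hN : 0 < N) {ζ : Fin N → E}
    (hζ : ∀ i, ζ i ∈ Ξ) (hr : 1 / (N : ℝ) * ∑ i, ‖ζ i - ξs i‖ ≤ r) :
    empirical ζ ∈ wassersteinBall Ξ (empirical ξs) r := by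
  refine ⟨isProbabilityMeasure_empirical hN,
    (ae_empirical_iff (fun ξ => ξ ∈ Ξ)).2 hζ,
    -- The coupling moves each point to its own perturbation.
    (iInf₂_le (empirical fun i => (ζ i, ξs i))
      ⟨map_empirical measurable_fst, map_empirical measurable_snd⟩).trans
      (le_trans (le_of_eq ?_) (ENNReal.ofReal_le_ofReal hr))⟩
  rw [empirical, lintegral_smul_measure, lintegral_finsetSum_measure, one_div,
    ENNReal.ofReal_mul (by positivity), ENNReal.ofReal_inv_of_pos (by exact_mod_cast hN),
    ENNReal.ofReal_natCast, ENNReal.ofReal_sum_of_nonneg (fun _ _ => norm_nonneg _), smul_eq_mul]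
  simp [lintegral_dirac, edist_dist, dist_eq_norm]

end Wasserstein

/-! ### Strong duality for a fixed payoff. -/

section Duality

variable {E : Type*} [NormedAddCommGroup E] [MeasurableSpace E] [BorelSpace E]
  [SecondCountableTopology E] {Ξ : Set E} {N : ℕ} {ξs : Fin N → E} {ρ : ℝ}

/-- The worst-case expectation is concave in the radius, so it has a supergradient at `ρ > 0`. -/
theorem exists_supergradient (hΞ : IsClosed Ξ) (hN : 0 < N) (hξs : ∀ i, ξs i ∈ Ξ) (hρ : 0 < ρ)
    {g : E → ℝ} (hg : Measurable (Ξ.domRestrict g)) {C : ℝ}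
    (hC : ∀ ξ ∈ Ξ, |g ξ| ≤ C * (1 + ‖ξ‖)) {V : ℝ}
    (hV : ∀ Q ∈ wassersteinBall Ξ (empirical ξs) ρ, ∫ ξ, g ξ ∂Q ≤ V) :
    ∃ κ, 0 ≤ κ ∧ ∀ r, 0 ≤ r → ∀ Q ∈ wassersteinBall Ξ (empirical ξs) r,
      ∫ ξ, g ξ ∂Q ≤ V + κ * (r - ρ) := by
  have hP : IsProbabilityMeasure (empirical ξs) := isProbabilityMeasure_empirical hN
  -- Slopes from `(ρ, V)` to values at larger radii. Adjoining `0` makes the supremum nonnegative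
  -- and the set nonempty.
  set S : Set ℝ := insert 0 {c | ∃ r, ρ < r ∧ ∃ Q ∈ wassersteinBall Ξ (empirical ξs) r,
    c = (∫ ξ, g ξ ∂Q - V) / (r - ρ)} with hS
  have hV1 : ∀ r₁ ≤ ρ, ∀ Q₁ ∈ wassersteinBall Ξ (empirical ξs) r₁, ∫ ξ, g ξ ∂Q₁ ≤ V :=
    fun r₁ h Q₁ hQ₁ => hV Q₁ ⟨hQ₁.1, hQ₁.2.1, hQ₁.2.2.trans (ENNReal.ofReal_le_ofReal h)⟩
  -- Slopes on the left dominate slopes on the right: the mixture of `Q₁` and `Q₂` with radius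
  -- exactly `ρ` has expectation at most `V`.
  have hub : ∀ r₁, 0 ≤ r₁ → r₁ < ρ → ∀ Q₁ ∈ wassersteinBall Ξ (empirical ξs) r₁,
      (V - ∫ ξ, g ξ ∂Q₁) / (ρ - r₁) ∈ upperBounds S := by
    rintro r₁ hr₁ h₁ Q₁ hQ₁ c (rfl | ⟨r₂, h₂, Q₂, hQ₂, rfl⟩)
    · exact div_nonneg (by linarith [hV1 r₁ h₁.le Q₁ hQ₁]) (by linarith)
    · have hd : 0 < r₂ - r₁ := by linarith
      have ha : 0 < (r₂ - ρ) / (r₂ - r₁) := div_pos (by linarith) hd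
      have hb : 0 < (ρ - r₁) / (r₂ - r₁) := div_pos (by linarith) hd
      have hmix := wassersteinBall_mix hQ₁ hQ₂ hr₁ (by linarith) ha hb (by field_simp; ring)
      have hr : (r₂ - ρ) / (r₂ - r₁) * r₁ + (ρ - r₁) / (r₂ - r₁) * r₂ = ρ := by
        field_simp; ring
      rw [hr] at hmix
      have h := hV _ hmix
      have i₁ := integrable_of_mem_wassersteinBall hΞ hN hQ₁ hg hC
      have i₂ := integrable_of_mem_wassersteinBall hΞ hN hQ₂ hg hC
      rw [integral_add_measure (i₁.smul_measure ENNReal.ofReal_ne_top)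
        (i₂.smul_measure ENNReal.ofReal_ne_top), integral_smul_measure, integral_smul_measure,
        ENNReal.toReal_ofReal ha.le, ENNReal.toReal_ofReal hb.le, smul_eq_mul, smul_eq_mul,
        div_mul_eq_mul_div, div_mul_eq_mul_div, ← add_div, div_le_iff₀ hd] at h
      rw [div_le_div_iff₀ (by linarith) (by linarith)]
      linarith
  have h0 : empirical ξs ∈ wassersteinBall Ξ (empirical ξs) 0 :=
    empirical_mem_wassersteinBall hN hξs (by simp)
  -- Here `ρ > 0` enters: radius `0` lies strictly to the left and its ball contains the empirical
  -- measure.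
  have hbdd : BddAbove S := ⟨_, hub 0 le_rfl hρ _ h0⟩
  refine ⟨sSup S, le_csSup hbdd (mem_insert _ _), fun r hr Q hQ => ?_⟩
  rcases lt_trichotomy r ρ with h | h | h
  · have := csSup_le ⟨0, mem_insert _ _⟩ (hub r hr h Q hQ)
    rw [le_div_iff₀ (by linarith)] at this
    linarith
  · have := hV1 r h.le Q hQ
    rw [h]
    linarith
  · have := le_csSup hbdd (mem_insert_of_mem _ ⟨r, h, Q, hQ, rfl⟩)
    rw [div_le_iff₀ (by linarith)] at this
    linarith

/-- Strong duality over the Wasserstein ball, with attainment of the dual problem. -/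
theorem exists_dual_solution (hΞ : IsClosed Ξ) (hN : 0 < N) (hξs : ∀ i, ξs i ∈ Ξ) (hρ : 0 < ρ)
    {g : E → ℝ} (hg : Measurable (Ξ.domRestrict g)) {C : ℝ}
    (hC : ∀ ξ ∈ Ξ, |g ξ| ≤ C * (1 + ‖ξ‖)) {V : ℝ}
    (hV : ∀ Q ∈ wassersteinBall Ξ (empirical ξs) ρ, ∫ ξ, g ξ ∂Q ≤ V) :
    ∃ κ, 0 ≤ κ ∧ ∃ s : Fin N → ℝ, (∀ ξ ∈ Ξ, ∀ i, g ξ - κ * ‖ξ - ξs i‖ ≤ s i) ∧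
      κ * ρ + 1 / (N : ℝ) * ∑ i, s i ≤ V := by
  obtain ⟨κ, hκ, h⟩ := exists_supergradient hΞ hN hξs hρ hg hC hV
  have hN' : (0 : ℝ) < N := by exact_mod_cast hN
  have : Nonempty Ξ := ⟨⟨_, hξs ⟨0, hN⟩⟩⟩
  -- The supergradient inequality at the empirical measure of `ζ`, with the mean displacement as
  -- radius.
  have key : ∀ ζ : Fin N → Ξ,
      ∑ i, (g (ζ i) - κ * ‖(ζ i : E) - ξs i‖) ≤ N * (V - κ * ρ) := by
    intro ζ
    have := h _ (by positivity) _ (empirical_mem_wassersteinBall (ξs := ξs) (ζ := fun i => (ζ i : E))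
      hN (fun i => (ζ i).2) le_rfl)
    rw [integral_empirical] at this
    rw [Finset.sum_sub_distrib, ← Finset.mul_sum]
    have e := mul_le_mul_of_nonneg_left this hN'.le
    field_simp at e
    linarith
  -- Only the `j`-th point is moved; the others stay put and pay no transport cost.
  have hbdd : ∀ j, BddAbove (range fun ξ : Ξ => g ξ - κ * ‖(ξ : E) - ξs j‖) := by
    intro j
    refine ⟨N * (V - κ * ρ) - ∑ i ∈ Finset.univ.erase j, g (ξs i), ?_⟩
    rintro _ ⟨ξ, rfl⟩
    have := key (Function.update (fun i => ⟨ξs i, hξs i⟩) j ξ)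
    rw [← Finset.add_sum_erase _ _ (Finset.mem_univ j), Function.update_self] at this
    have e : ∑ i ∈ Finset.univ.erase j, g (ξs i) = ∑ i ∈ Finset.univ.erase j,
        (g ((Function.update (fun i => (⟨ξs i, hξs i⟩ : Ξ)) j ξ i : Ξ) : E) -
          κ * ‖((Function.update (fun i => (⟨ξs i, hξs i⟩ : Ξ)) j ξ i : Ξ) : E) - ξs i‖) := by
      refine Finset.sum_congr rfl fun i hi => ?_
      rw [Function.update_of_ne (Finset.ne_of_mem_erase hi)]
      simp
    rw [← e] at this
    simp only
    linarith
  refine ⟨κ, hκ, fun i => ⨆ ξ : Ξ, (g ξ - κ * ‖(ξ : E) - ξs i‖),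
    fun ξ hξ i => le_ciSup (hbdd i) ⟨ξ, hξ⟩, ?_⟩
  -- The points vary independently, so choosing each one `ε / N`-optimally turns `key` into a bound
  -- on the sum of suprema.
  have hsum : ∑ i, ⨆ ξ : Ξ, (g ξ - κ * ‖(ξ : E) - ξs i‖) ≤ N * (V - κ * ρ) := by
    refine le_of_forall_pos_le_add fun ε hε => ?_
    choose ζ hζ using fun i => exists_lt_of_lt_ciSup
      (sub_lt_self (⨆ ξ : Ξ, (g ξ - κ * ‖(ξ : E) - ξs i‖)) (div_pos hε hN'))
    have h1 := Finset.sum_le_sum fun i (_ : i ∈ Finset.univ) => (hζ i).le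
    rw [Finset.sum_sub_distrib] at h1
    have h2 : ∑ _i : Fin N, ε / (N : ℝ) = ε := by
      simp; field_simp
    linarith [key ζ]
  have := mul_le_mul_of_nonneg_left hsum (one_div_nonneg.2 hN'.le)
  field_simp at this ⊢
  linarith

end Duality

/-! ### The mean-CVaR functional and its thresholds. -/

section RiskMeasure

variable {α lam : ℝ}

theorem effWeight_nonneg (hlamα : lam ≤ α) (hα : α < 1) : 0 ≤ effWeight α lam :=
  div_nonneg (by linarith) (by linarith)

theorem effWeight_lt_one (hlamα : lam ≤ α) (hα : α < 1) : effWeight α lam < 1 := by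
  rw [effWeight, div_lt_one (by linarith)]
  linarith

theorem pos_of_effWeight_pos (hlam : 0 ≤ lam) (hlamα : lam ≤ α) (h : 0 < effWeight α lam) :
    0 < α := by
  refine lt_of_le_of_ne (hlam.trans hlamα) fun h0 => ?_
  have : α - lam = 0 := by linarith
  simp [effWeight, this] at h

theorem continuous_hingePayoff (t : ℝ) : Continuous (hingePayoff α lam t) := by
  unfold hingePayoff
  fun_prop

theorem convexOn_hingePayoff (hlamα : lam ≤ α) (hα : α < 1) :
    ConvexOn ℝ univ fun p : ℝ × ℝ => hingePayoff α lam p.1 p.2 := by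
  have hb := effWeight_nonneg hlamα hα
  have hb1 := effWeight_lt_one hlamα hα
  have hlin : ConvexOn ℝ univ fun p : ℝ × ℝ => p.2 := (LinearMap.snd ℝ ℝ ℝ).convexOn convex_univ
  have hdiff : ConvexOn ℝ univ fun p : ℝ × ℝ => p.2 - p.1 :=
    (LinearMap.snd ℝ ℝ ℝ - LinearMap.fst ℝ ℝ ℝ).convexOn convex_univ
  exact (hlin.smul (by linarith : 0 ≤ 1 - effWeight α lam)).add
    ((hdiff.sup (convexOn_const 0 convex_univ)).smul
      (div_nonneg hb (by linarith : 0 ≤ 1 - α)))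

theorem hingePayoff_mono (hlamα : lam ≤ α) (hα : α < 1) (t : ℝ) :
    Monotone (hingePayoff α lam t) := by
  intro y z h
  have hb := effWeight_nonneg hlamα hα
  have hb1 := effWeight_lt_one hlamα hα
  exact add_le_add (mul_le_mul_of_nonneg_left h (by linarith))
    (mul_le_mul_of_nonneg_left (max_le_max (by linarith) le_rfl)
      (div_nonneg hb (by linarith)))

/-- The hinge-augmented payoff inherits linear growth. -/
theorem abs_hingePayoff_le (hlamα : lam ≤ α) (hα : α < 1) (t z : ℝ) :
    |hingePayoff α lam t z| ≤
      |z| + effWeight α lam / (1 - α) * (|z| + |t|) := by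
  have hb := effWeight_nonneg hlamα hα
  have hb1 := effWeight_lt_one hlamα hα
  refine (abs_add_le _ _).trans (add_le_add ?_ ?_)
  · rw [abs_mul, abs_of_nonneg (by linarith : 0 ≤ 1 - effWeight α lam)]
    exact mul_le_of_le_one_left (abs_nonneg _) (by linarith)
  · have hc : 0 ≤ effWeight α lam / (1 - α) := div_nonneg hb (by linarith)
    rw [abs_mul, abs_of_nonneg hc, abs_of_nonneg (le_max_right _ _)]
    exact mul_le_mul_of_nonneg_left (max_le ((le_abs_self _).trans (abs_sub _ _)) (by positivity)) hc

/-- The Lipschitz constant in `t` does not depend on the cost, hence survives integration and the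
supremum over `Q`. -/
theorem abs_hingePayoff_sub_le (hlamα : lam ≤ α) (hα : α < 1) (t t' z : ℝ) :
    |hingePayoff α lam t z - hingePayoff α lam t' z| ≤
      effWeight α lam / (1 - α) * |t - t'| := by
  have hc : 0 ≤ effWeight α lam / (1 - α) :=
    div_nonneg (effWeight_nonneg hlamα hα) (by linarith)
  have e : hingePayoff α lam t z - hingePayoff α lam t' z =
      effWeight α lam / (1 - α) * (max (z - t) 0 - max (z - t') 0) := by
    unfold hingePayoff; ring
  rw [e, abs_mul, abs_of_nonneg hc]
  refine mul_le_mul_of_nonneg_left ((abs_max_sub_max_le_abs _ _ _).trans (le_of_eq ?_)) hc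
  rw [abs_sub_comm t t']
  congr 1
  ring

theorem measurable_hingePayoff {E : Type*} [MeasurableSpace E] {Ξ : Set E} {Y : E → ℝ}
    (hY : Measurable (Ξ.domRestrict Y)) (t : ℝ) :
    Measurable (Ξ.domRestrict fun ξ => hingePayoff α lam t (Y ξ)) :=
  (continuous_hingePayoff t).measurable.comp hY

theorem exists_growth_hingePayoff {E : Type*} [NormedAddCommGroup E] {Ξ : Set E} {Y : E → ℝ}
    (hlamα : lam ≤ α) (hα : α < 1)
    (hgrowth : ∃ C : ℝ, ∀ ξ ∈ Ξ, |Y ξ| ≤ C * (1 + ‖ξ‖)) (t : ℝ) :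
    ∃ C : ℝ, 0 ≤ C ∧ ∀ ξ ∈ Ξ, |hingePayoff α lam t (Y ξ)| ≤ C * (1 + ‖ξ‖) := by
  obtain ⟨C, hC⟩ := hgrowth
  have hc : 0 ≤ effWeight α lam / (1 - α) :=
    div_nonneg (effWeight_nonneg hlamα hα) (by linarith)
  refine ⟨|C| + effWeight α lam / (1 - α) * (|C| + |t|), by positivity, fun ξ hξ => ?_⟩
  have h1 : |Y ξ| ≤ |C| * (1 + ‖ξ‖) :=
    (hC ξ hξ).trans (mul_le_mul_of_nonneg_right (le_abs_self C) (by positivity))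
  have h2 : |t| ≤ |t| * (1 + ‖ξ‖) := le_mul_of_one_le_right (abs_nonneg _) (by simp)
  have h3 := mul_le_mul_of_nonneg_left (add_le_add h1 h2) hc
  linarith [abs_hingePayoff_le hlamα hα t (Y ξ)]

variable {E : Type*} [MeasurableSpace E] {Q : Measure E} [IsProbabilityMeasure Q] {Y : E → ℝ}

theorem integrable_hinge (hY : Integrable Y Q) (t : ℝ) :
    Integrable (fun ξ => max (Y ξ - t) 0) Q :=
  (hY.sub (integrable_const t)).pos_part

theorem integrable_hingePayoff (hY : Integrable Y Q) (t : ℝ) :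
    Integrable (fun ξ => hingePayoff α lam t (Y ξ)) Q :=
  (hY.const_mul _).add ((integrable_hinge hY t).const_mul _)

theorem integral_hingePayoff (hY : Integrable Y Q) (t : ℝ) :
    ∫ ξ, hingePayoff α lam t (Y ξ) ∂Q = (1 - effWeight α lam) * ∫ ξ, Y ξ ∂Q +
      effWeight α lam / (1 - α) * ∫ ξ, max (Y ξ - t) 0 ∂Q := by
  unfold hingePayoff
  rw [integral_add (hY.const_mul _) ((integrable_hinge hY t).const_mul _), integral_const_mul,
    integral_const_mul]

theorem integral_sub_le_integral_hinge (hY : Integrable Y Q) (t : ℝ) :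
    ∫ ξ, Y ξ ∂Q - t ≤ ∫ ξ, max (Y ξ - t) 0 ∂Q := by
  have := integral_mono (hY.sub (integrable_const t)) (integrable_hinge hY t)
    fun ξ => le_max_left _ _
  simpa [integral_sub hY (integrable_const t)] using this

/-- The mean is a lower bound, because `1 / (1 - α) ≥ 1` and the expected hinge is at least `0` and
at least the mean minus `γ`. Without a lower bound the real infimum would be the default value `0`.
-/
theorem bddBelow_cvar (hα0 : 0 ≤ α) (hα : α < 1) (hY : Integrable Y Q) :
    BddBelow (range fun γ : ℝ => γ + 1 / (1 - α) * ∫ ξ, max (Y ξ - γ) 0 ∂Q) := by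
  refine ⟨∫ ξ, Y ξ ∂Q, ?_⟩
  rintro _ ⟨γ, rfl⟩
  have h0 : 0 ≤ ∫ ξ, max (Y ξ - γ) 0 ∂Q := integral_nonneg fun _ => le_max_right _ _
  have h1 : 1 ≤ 1 / (1 - α) := by
    rw [le_div_iff₀ (by linarith)]
    linarith
  have := integral_sub_le_integral_hinge hY γ
  simp only
  nlinarith

/-- The mean-CVaR functional as an infimum over thresholds. -/
theorem meanCVaR_eq_iInf (hα0 : 0 ≤ α) (hlamα : lam ≤ α) (hα : α < 1) (hY : Integrable Y Q) :
    meanCVaR α lam Q Y =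
      ⨅ t : ℝ, (effWeight α lam * t + ∫ ξ, hingePayoff α lam t (Y ξ) ∂Q) := by
  have h := Real.mul_iInf_of_nonneg (effWeight_nonneg hlamα hα)
    fun γ : ℝ => γ + 1 / (1 - α) * ∫ ξ, max (Y ξ - γ) 0 ∂Q
  have e : ∀ t : ℝ, effWeight α lam * t + ∫ ξ, hingePayoff α lam t (Y ξ) ∂Q =
      (1 - effWeight α lam) * ∫ ξ, Y ξ ∂Q +
        effWeight α lam * (t + 1 / (1 - α) * ∫ ξ, max (Y ξ - t) 0 ∂Q) := by
    intro t
    rw [integral_hingePayoff hY]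
    ring
  simp only [e]
  rw [meanCVaR, cvar, h]
  refine (OrderIso.addLeft ((1 - effWeight α lam) * ∫ ξ, Y ξ ∂Q)).map_ciInf ?_
  obtain ⟨m, hm⟩ := bddBelow_cvar hα0 hα hY
  refine ⟨effWeight α lam * m, ?_⟩
  rintro _ ⟨γ, rfl⟩
  exact mul_le_mul_of_nonneg_left (hm ⟨γ, rfl⟩) (effWeight_nonneg hlamα hα)

theorem bddBelow_threshold (hα0 : 0 ≤ α) (hlamα : lam ≤ α) (hα : α < 1) (hY : Integrable Y Q) :
    BddBelow (range fun t : ℝ => effWeight α lam * t + ∫ ξ, hingePayoff α lam t (Y ξ) ∂Q) := by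
  refine ⟨∫ ξ, Y ξ ∂Q, ?_⟩
  rintro _ ⟨t, rfl⟩
  have h0 : 0 ≤ ∫ ξ, max (Y ξ - t) 0 ∂Q := integral_nonneg fun _ => le_max_right _ _
  have hb := effWeight_nonneg hlamα hα
  have h1 : effWeight α lam ≤ effWeight α lam / (1 - α) := by
    rw [le_div_iff₀ (by linarith)]
    nlinarith
  have := integral_sub_le_integral_hinge hY t
  simp only [integral_hingePayoff hY]
  nlinarith [mul_le_mul_of_nonneg_right h1 h0, mul_le_mul_of_nonneg_left this hb]

theorem meanCVaR_le (hα0 : 0 ≤ α) (hlamα : lam ≤ α) (hα : α < 1) (hY : Integrable Y Q) (t : ℝ) :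
    meanCVaR α lam Q Y ≤ effWeight α lam * t + ∫ ξ, hingePayoff α lam t (Y ξ) ∂Q := by
  rw [meanCVaR_eq_iInf hα0 hlamα hα hY]
  exact ciInf_le (bddBelow_threshold hα0 hlamα hα hY) t

theorem iInf_le_meanCVaR (hα0 : 0 ≤ α) (hlamα : lam ≤ α) (hα : α < 1) (hY : Integrable Y Q) :
    ⨅ t : ℝ, ((effWeight α lam * t + ∫ ξ, hingePayoff α lam t (Y ξ) ∂Q : ℝ) : EReal) ≤
      (meanCVaR α lam Q Y : ℝ) := by
  rw [meanCVaR_eq_iInf hα0 hlamα hα hY]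
  refine le_of_forall_gt fun c hc => ?_
  obtain ⟨x, hx, hxc⟩ := EReal.lt_iff_exists_real_btwn.1 hc
  obtain ⟨t, ht⟩ := exists_lt_of_ciInf_lt (EReal.coe_lt_coe_iff.1 hx)
  exact (iInf_le _ t).trans_lt ((EReal.coe_lt_coe_iff.2 ht).trans hxc)

/-- The worst-case threshold problem has a minimizer. -/
theorem exists_isMin_threshold (hlam : 0 ≤ lam) (hlamα : lam ≤ α) (hα : α < 1)
    {D : Set (Measure E)} (hD : D.Nonempty) (hprob : ∀ Q ∈ D, IsProbabilityMeasure Q)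
    (hint : ∀ Q ∈ D, Integrable Y Q)
    (hbdd : ∀ t : ℝ, BddAbove (range fun Q : D =>
      effWeight α lam * t + ∫ ξ, hingePayoff α lam t (Y ξ) ∂(Q : Measure E))) :
    ∃ t₀ : ℝ, ∀ t : ℝ,
      (⨆ Q : D, (effWeight α lam * t₀ + ∫ ξ, hingePayoff α lam t₀ (Y ξ) ∂(Q : Measure E))) ≤
      ⨆ Q : D, (effWeight α lam * t + ∫ ξ, hingePayoff α lam t (Y ξ) ∂(Q : Measure E)) := by
  have hne : Nonempty D := hD.to_subtype
  set F : ℝ → ℝ := fun t => ⨆ Q : D,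
    (effWeight α lam * t + ∫ ξ, hingePayoff α lam t (Y ξ) ∂(Q : Measure E)) with hF
  set b := effWeight α lam with hbdef
  have hb : 0 ≤ b := effWeight_nonneg hlamα hα
  have hb1 : b < 1 := effWeight_lt_one hlamα hα
  set c := b / (1 - α) with hc
  have hc0 : 0 ≤ c := div_nonneg hb (by linarith)
  -- With weight `0` the objective is constant in `t`, so coercivity fails but every threshold is
  -- optimal.
  rcases hb.eq_or_lt with hb0 | hbpos
  · refine ⟨0, fun t => le_of_eq ?_⟩
    have : ∀ t z, hingePayoff α lam t z = z := fun t z => by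
      simp [hingePayoff, ← hbdef, ← hb0]
    simp [this, ← hb0]
  have hLip : ∀ t t', F t ≤ F t' + (b + c) * |t - t'| := by
    intro t t'
    refine ciSup_le fun Q => ?_
    have := hprob Q Q.2
    have i1 := integrable_hingePayoff (α := α) (lam := lam) (hint Q Q.2) t
    have i2 := integrable_hingePayoff (α := α) (lam := lam) (hint Q Q.2) t'
    have h1 : ∫ ξ, hingePayoff α lam t (Y ξ) ∂(Q : Measure E) ≤
        ∫ ξ, (hingePayoff α lam t' (Y ξ) + c * |t - t'|) ∂(Q : Measure E) := by
      refine integral_mono i1 (i2.add (integrable_const _)) fun ξ => ?_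
      have := (abs_le.1 (abs_hingePayoff_sub_le hlamα hα t t' (Y ξ))).2
      simp only
      linarith
    rw [integral_add i2 (integrable_const _), integral_const, probReal_univ, one_smul] at h1
    have h2 := le_ciSup (hbdd t') Q
    have h3 : b * (t - t') ≤ b * |t - t'| := mul_le_mul_of_nonneg_left (le_abs_self _) hb
    linarith
  have hcont : Continuous F := by
    refine (LipschitzWith.of_le_add_mul (Real.toNNReal (b + c)) fun t t' => ?_).continuous
    rw [Real.coe_toNNReal _ (by positivity), Real.dist_eq]
    exact hLip t t'
  have hαpos := pos_of_effWeight_pos hlam hlamα hbpos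
  -- Positive weight forces `α > 0`; this gives growth as `t → -∞`.
  have hcb : b < c := by
    rw [hc, lt_div_iff₀ (by linarith)]
    nlinarith
  obtain ⟨Q₀, hQ₀⟩ := hD
  have := hprob Q₀ hQ₀
  set e := ∫ ξ, Y ξ ∂Q₀ with he
  -- One `Q₀` already gives coercivity: for `t ≥ 0` drop the hinge, leaving slope `b`; for `t ≤ 0`
  -- bound the expected hinge below by `e - t`, leaving growth rate `c - b`.
  have hlow : ∀ t, min b (c - b) * ‖t‖ + -((1 + c) * |e|) ≤ F t := by
    intro t
    refine le_trans ?_ (le_ciSup (hbdd t) ⟨Q₀, hQ₀⟩)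
    simp only
    rw [integral_hingePayoff (hint Q₀ hQ₀), ← he, ← hbdef, ← hc, Real.norm_eq_abs]
    have h0 : 0 ≤ ∫ ξ, max (Y ξ - t) 0 ∂Q₀ := integral_nonneg fun _ => le_max_right _ _
    have h1 := integral_sub_le_integral_hinge (hint Q₀ hQ₀) t
    rw [← he] at h1
    have h2 := neg_abs_le e
    have h4 : -|e| ≤ (1 - b) * e := by nlinarith [abs_nonneg e]
    have h3 : (1 + c) * |e| = |e| + c * |e| := by ring
    have h7 : 0 ≤ c * |e| := by positivity
    rcases le_total 0 t with ht | ht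
    · rw [abs_of_nonneg ht]
      have h5 := mul_le_mul_of_nonneg_right (min_le_left b (c - b)) ht
      have h6 := mul_nonneg hc0 h0
      linarith
    · rw [abs_of_nonpos ht]
      have h5 := mul_le_mul_of_nonneg_right (min_le_right b (c - b)) (neg_nonneg.2 ht)
      have h6 := mul_le_mul_of_nonneg_left h1 hc0
      have h8 := mul_le_mul_of_nonneg_left h2 hc0
      linarith
  refine hcont.exists_forall_le (Filter.tendsto_atTop_mono hlow ?_)
  exact Filter.tendsto_atTop_add_const_right _ _
    (tendsto_norm_cocompact_atTop.const_mul_atTop (lt_min hbpos (by linarith)))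

end RiskMeasure

/-! ### Duality for the robust mean-CVaR problem. -/

section RobustDuality

variable {E : Type*} [NormedAddCommGroup E] [MeasurableSpace E] [BorelSpace E]
  [SecondCountableTopology E] {Ξ : Set E} {N : ℕ} {ξs : Fin N → E} {ρ α lam : ℝ} {Y : E → ℝ}

/-- The growth constant is itself a feasible multiplier: `κ = C` and `s i = C * (1 + ‖ξs i‖)`
satisfy the weak duality constraints by the triangle inequality. -/
theorem bddAbove_worstCase (hΞ : IsClosed Ξ) (hN : 0 < N) (hξs : ∀ i, ξs i ∈ Ξ) (hρ : 0 ≤ ρ)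
    {g : E → ℝ} (hg : Measurable (Ξ.domRestrict g)) {C : ℝ} (hC0 : 0 ≤ C)
    (hC : ∀ ξ ∈ Ξ, |g ξ| ≤ C * (1 + ‖ξ‖)) :
    ∃ V, ∀ Q ∈ wassersteinBall Ξ (empirical ξs) ρ, ∫ ξ, g ξ ∂Q ≤ V := by
  refine ⟨_, fun Q hQ => integral_le_of_mem_wassersteinBall hN hρ hξs hQ
    (integrable_of_mem_wassersteinBall hΞ hN hQ hg hC) hC0 (s := fun i => C * (1 + ‖ξs i‖))
    fun ξ hξ i => ?_⟩
  have h1 := (le_abs_self _).trans (hC ξ hξ)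
  have h2 := mul_le_mul_of_nonneg_left (norm_le_norm_sub_add ξ (ξs i)) hC0
  linarith

/-- The min-max form of the robust mean-CVaR problem has an attained dual. -/
theorem exists_robust_dual_solution (hΞ : IsClosed Ξ) (hN : 0 < N) (hξs : ∀ i, ξs i ∈ Ξ)
    (hρ : 0 < ρ) (hlam : 0 ≤ lam) (hlamα : lam ≤ α) (hα : α < 1)
    (hY : Measurable (Ξ.domRestrict Y)) (hgrowth : ∃ C : ℝ, ∀ ξ ∈ Ξ, |Y ξ| ≤ C * (1 + ‖ξ‖)) :
    ∃ (t κ : ℝ) (s : Fin N → ℝ), 0 ≤ κ ∧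
      (∀ ξ ∈ Ξ, ∀ i, hingePayoff α lam t (Y ξ) - κ * ‖ξ - ξs i‖ ≤ s i) ∧
      ((effWeight α lam * t + κ * ρ + 1 / (N : ℝ) * ∑ i, s i : ℝ) : EReal) ≤
        ⨅ t : ℝ, ⨆ Q ∈ wassersteinBall Ξ (empirical ξs) ρ,
          ((effWeight α lam * t + ∫ ξ, hingePayoff α lam t (Y ξ) ∂Q : ℝ) : EReal) := by
  set D := wassersteinBall Ξ (empirical ξs) ρ with hD
  have hne : D.Nonempty := ⟨_, empirical_mem_wassersteinBall hN hξs (by simpa using hρ.le)⟩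
  have : Nonempty D := hne.to_subtype
  have hbdd : ∀ t : ℝ, BddAbove (range fun Q : D =>
      effWeight α lam * t + ∫ ξ, hingePayoff α lam t (Y ξ) ∂(Q : Measure E)) := by
    intro t
    obtain ⟨C, hC0, hC⟩ := exists_growth_hingePayoff hlamα hα hgrowth t
    obtain ⟨V, hV⟩ := bddAbove_worstCase hΞ hN hξs hρ.le (measurable_hingePayoff hY t) hC0 hC
    refine ⟨effWeight α lam * t + V, ?_⟩
    rintro _ ⟨Q, rfl⟩
    exact add_le_add le_rfl (hV Q Q.2)
  obtain ⟨C, hC⟩ := hgrowth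
  -- Minimize over the threshold first, then dualize at `t₀` alone.
  obtain ⟨t₀, ht₀⟩ := exists_isMin_threshold hlam hlamα hα hne (fun Q hQ => hQ.1)
    (fun Q hQ => integrable_of_mem_wassersteinBall hΞ hN hQ hY hC) hbdd
  obtain ⟨C', -, hC'⟩ := exists_growth_hingePayoff hlamα hα ⟨C, hC⟩ t₀
  obtain ⟨κ, hκ, s, hs, hle⟩ := exists_dual_solution hΞ hN hξs hρ (measurable_hingePayoff hY t₀) hC'
    (fun Q hQ => le_sub_iff_add_le'.2 (le_ciSup (hbdd t₀) ⟨Q, hQ⟩))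
  refine ⟨t₀, κ, s, hκ, hs, le_iInf fun t => ?_⟩
  refine (EReal.coe_le_coe_iff.2 ((?_ : _ ≤ _).trans (ht₀ t))).trans ?_
  · linarith
  · refine le_of_forall_lt fun c hc => ?_
    obtain ⟨x, hcx, hx⟩ := EReal.lt_iff_exists_real_btwn.1 hc
    obtain ⟨Q, hQ⟩ := exists_lt_of_lt_ciSup (EReal.coe_lt_coe_iff.1 hx)
    exact (hcx.trans (EReal.coe_lt_coe_iff.2 hQ)).trans_le
      (le_iSup₂ (f := fun Q (_ : Q ∈ D) => ((effWeight α lam * t +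
        ∫ ξ, hingePayoff α lam t (Y ξ) ∂Q : ℝ) : EReal)) Q.1 Q.2)

end RobustDuality

/-! ### Convexity of the potential and of the program. -/

/-- Slopes of the primitive are averages of `h`; those over adjacent intervals are separated by the
value of `h` at the common endpoint. -/
theorem convexOn_intervalIntegral_of_monotoneOn {h : ℝ → ℝ} (hh : MonotoneOn h (Ici 0)) :
    ConvexOn ℝ (Ici 0) fun x => ∫ ω in (0 : ℝ)..x, h ω := by
  have hint : ∀ {x y : ℝ}, 0 ≤ x → 0 ≤ y → IntervalIntegrable h volume x y := fun hx hy =>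
    (hh.mono fun _ hz => (le_min hx hy).trans hz.1).intervalIntegrable
  refine convexOn_of_slope_mono_adjacent (convex_Ici 0) fun {x y z} hx hz hxy hyz => ?_
  have hx : 0 ≤ x := hx
  have hy : 0 ≤ y := hx.trans hxy.le
  have hz : 0 ≤ z := hz
  rw [intervalIntegral.integral_interval_sub_left (hint le_rfl hy) (hint le_rfl hx),
    intervalIntegral.integral_interval_sub_left (hint le_rfl hz) (hint le_rfl hy)]
  trans h y
  · rw [div_le_iff₀ (by linarith)]
    have := intervalIntegral.integral_mono_on hxy.le (hint hx hy)
      (intervalIntegrable_const (c := h y)) fun w hw => hh (hx.trans hw.1) hy hw.2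
    simpa [mul_comm] using this
  · rw [le_div_iff₀ (by linarith)]
    have := intervalIntegral.integral_mono_on hyz.le (intervalIntegrable_const (c := h y))
      (hint hy hz) fun w hw => hh hy (hy.trans hw.1) hw.1
    simpa [mul_comm] using this

theorem convexOn_entropy : ConvexOn ℝ (Ici 0) fun x : ℝ => (x + 1) * Real.log (x + 1) - x := by
  refine ⟨convex_Ici 0, fun x hx y hy a b ha hb hab => ?_⟩
  have hx : 0 ≤ x := hx
  have hy : 0 ≤ y := hy
  have h := Real.convexOn_mul_log.2 (x := x + 1) (y := y + 1) (mem_Ici.2 (by linarith))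
    (mem_Ici.2 (by linarith)) ha hb hab
  have e : a • (x + 1) + b • (y + 1) = a • x + b • y + 1 := by
    simp only [smul_eq_mul]
    linear_combination hab
  rw [e] at h
  simp only [smul_eq_mul] at h ⊢
  linarith

theorem ConvexOn.finset_sum {V ι : Type*} [AddCommGroup V] [Module ℝ V] {S : Set V}
    (hS : Convex ℝ S) {F : ι → V → ℝ} (I : Finset ι) (h : ∀ i ∈ I, ConvexOn ℝ S (F i)) :
    ConvexOn ℝ S fun x => ∑ i ∈ I, F i x := by
  classical
  induction I using Finset.induction_on with
  | empty => simpa using convexOn_const 0 hS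
  | insert i I hi ih =>
    simp only [Finset.sum_insert hi]
    exact (h i (Finset.mem_insert_self _ _)).add
      (ih fun j hj => h j (Finset.mem_insert_of_mem hj))

namespace TrafficNetwork

section Convexity

variable {A W : Type*} {K : W → Type*} {m : ℕ} [Fintype W] [∀ w, Fintype (K w)]
  (net : TrafficNetwork A W K m)

/-- The link flow as a linear function of the route flow. -/
noncomputable def linkFlowLinear (a : A) : (∀ w, K w → ℝ) →ₗ[ℝ] ℝ where
  toFun f := net.linkFlow f a
  map_add' f g := by simp [linkFlow, add_mul, Finset.sum_add_distrib]
  map_smul' c f := by simp [linkFlow, mul_assoc, Finset.mul_sum]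

theorem convex_feasible : Convex ℝ net.feasible := by
  intro f hf g hg a b ha hb hab
  refine ⟨fun w => ?_, fun w k => ?_, fun l => ?_⟩
  · simp only [Pi.add_apply, Pi.smul_apply, smul_eq_mul, Finset.sum_add_distrib,
      ← Finset.mul_sum, hf.1 w, hg.1 w]
    rw [← add_mul, hab, one_mul]
  · exact add_nonneg (mul_nonneg ha (hf.2.1 w k)) (mul_nonneg hb (hg.2.1 w k))
  · have e : net.linkFlow (a • f + b • g) l = a * net.linkFlow f l + b * net.linkFlow g l := by
      have := (net.linkFlowLinear l).map_add (a • f) (b • g)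
      rwa [map_smul, map_smul] at this
    rw [e]
    exact add_nonneg (mul_nonneg ha (hf.2.2 l)) (mul_nonneg hb (hg.2.2 l))

theorem convex_sipDomain (N : ℕ) : Convex ℝ (net.sipDomain N) := fun _ hp _ hq _ _ ha hb hab =>
  ⟨net.convex_feasible hp.1 hq.1 ha hb hab, add_nonneg (mul_nonneg ha hp.2) (mul_nonneg hb hq.2)⟩

theorem convexOn_sipObjective (α lam ρ : ℝ) (N : ℕ) :
    ConvexOn ℝ (net.sipDomain N) (net.sipObjective (N := N) α lam ρ) := by
  refine ⟨net.convex_sipDomain N, fun p _ q _ a b _ _ _ => le_of_eq ?_⟩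
  simp only [sipObjective, Prod.fst_add, Prod.snd_add, Prod.smul_fst, Prod.smul_snd, Pi.add_apply,
    Pi.smul_apply, smul_eq_mul, Finset.sum_add_distrib, ← Finset.mul_sum]
  ring

variable [Fintype A]

/-- Each summand is a convex function on `[0, ∞)` after a linear map of `f`; feasibility keeps link
and route flows in that half-line. -/
theorem convexOn_potential {ξ : EuclideanSpace ℝ (Fin m)}
    (hmono : ∀ a, MonotoneOn (fun ω => net.travelTime a ω ξ) (Ici 0)) :
    ConvexOn ℝ net.feasible fun f => net.potential f ξ := by
  have hc := net.convex_feasible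
  refine (ConvexOn.finset_sum hc _ fun a _ => ?_).add
    ((ConvexOn.finset_sum hc _ fun w _ => ConvexOn.finset_sum hc _ fun k _ => ?_).smul
      (one_div_nonneg.2 net.θ_pos.le))
  · exact ((convexOn_intervalIntegral_of_monotoneOn (hmono a)).comp_linearMap
      (net.linkFlowLinear a)).subset (fun f hf => hf.2.2 a) hc
  · exact (convexOn_entropy.comp_linearMap ((LinearMap.proj k).comp
      (LinearMap.proj (φ := fun w => K w → ℝ) w : (∀ w, K w → ℝ) →ₗ[ℝ] (K w → ℝ)))).subset
      (fun f hf => hf.2.1 w k) hc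

theorem convexOn_sipConstraint {α lam : ℝ} (hlamα : lam ≤ α) (hα : α < 1) {N : ℕ}
    (ξs : Fin N → EuclideanSpace ℝ (Fin m)) {ξ : EuclideanSpace ℝ (Fin m)}
    (hmono : ∀ a, MonotoneOn (fun ω => net.travelTime a ω ξ) (Ici 0)) (i : Fin N) :
    ConvexOn ℝ (net.sipDomain N) (net.sipConstraint α lam ξs ξ i) := by
  refine ⟨net.convex_sipDomain N, fun p hp q hq a b ha hb hab => ?_⟩
  have h1 := (net.convexOn_potential hmono).2 hp.1 hq.1 ha hb hab
  have h2 := (convexOn_hingePayoff hlamα hα).2 (mem_univ (p.2.1, net.potential p.1 ξ))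
    (mem_univ (q.2.1, net.potential q.1 ξ)) ha hb hab
  -- Monotonicity in the cost carries the convexity of the potential through the hinge; the
  -- transport term is linear in `κ`.
  have h3 := hingePayoff_mono hlamα hα (a • p.2.1 + b • q.2.1) h1
  simp only [sipConstraint, payoff, Prod.fst_add, Prod.snd_add, Prod.smul_fst, Prod.smul_snd,
    Pi.add_apply, Pi.smul_apply, smul_eq_mul] at h2 h3 ⊢
  linarith

theorem convex_sipFeasible {α lam : ℝ} (hlamα : lam ≤ α) (hα : α < 1) {N : ℕ}
    (ξs : Fin N → EuclideanSpace ℝ (Fin m)) {Ξ : Set (EuclideanSpace ℝ (Fin m))}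
    (hmono : ∀ a, ∀ ξ ∈ Ξ, MonotoneOn (fun ω => net.travelTime a ω ξ) (Ici 0)) :
    Convex ℝ (net.sipFeasible α lam Ξ ξs) := by
  intro p hp q hq a b ha hb hab
  refine ⟨net.convex_sipDomain N hp.1 hq.1 ha hb hab, fun ξ hξ i => ?_⟩
  exact ((net.convexOn_sipConstraint hlamα hα ξs (fun l => hmono l ξ hξ) i).convex_le 0
    ⟨hp.1, hp.2 ξ hξ i⟩ ⟨hq.1, hq.2 ξ hξ i⟩ ha hb hab).2

end Convexity

end TrafficNetwork

/-! ### Sums in the extended reals. -/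

theorem EReal.coe_finset_sum {ι : Type*} (I : Finset ι) (s : ι → ℝ) :
    ((∑ i ∈ I, s i : ℝ) : EReal) = ∑ i ∈ I, (s i : EReal) := by
  classical
  induction I using Finset.induction_on with
  | empty => simp
  | insert i I hi ih => rw [Finset.sum_insert hi, Finset.sum_insert hi, EReal.coe_add, ih]

theorem EReal.finset_sum_ne_bot {ι : Type*} {I : Finset ι} {x : ι → EReal}
    (h : ∀ i ∈ I, x i ≠ ⊥) : ∑ i ∈ I, x i ≠ ⊥ := by
  classical
  induction I using Finset.induction_on with
  | empty => simp
  | insert i I hi ih =>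
    rw [Finset.sum_insert hi, Ne, EReal.add_eq_bot_iff, not_or]
    exact ⟨h i (Finset.mem_insert_self _ _), ih fun j hj => h j (Finset.mem_insert_of_mem hj)⟩

/-- Since `⊥ + ⊤ = ⊥`, the other terms must avoid `⊥`. -/
theorem EReal.finset_sum_eq_top {ι : Type*} {I : Finset ι} {x : ι → EReal}
    (h : ∀ i ∈ I, x i ≠ ⊥) {j : ι} (hj : j ∈ I) (hx : x j = ⊤) : ∑ i ∈ I, x i = ⊤ := by
  classical
  rw [← Finset.add_sum_erase I x hj, hx]
  exact EReal.top_add_of_ne_bot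
    (EReal.finset_sum_ne_bot fun i hi => h i (Finset.mem_of_mem_erase hi))

/-! ### Comparing the robust value, the dual bound and the program. -/

namespace TrafficNetwork

section Reformulation

variable {A W : Type*} {K : W → Type*} {m N : ℕ} [Fintype A] [Fintype W] [∀ w, Fintype (K w)]
  (net : TrafficNetwork A W K m) {Ξ : Set (EuclideanSpace ℝ (Fin m))}
  {ξs : Fin N → EuclideanSpace ℝ (Fin m)} {ρ α lam : ℝ} {f : ∀ w, K w → ℝ}

theorem droObjective_le_sipObjective (hΞ : IsClosed Ξ) (hN : 0 < N) (hξs : ∀ i, ξs i ∈ Ξ)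
    (hρ : 0 ≤ ρ) (hα0 : 0 ≤ α) (hlamα : lam ≤ α) (hα : α < 1)
    (hmeas : Measurable (Ξ.domRestrict (net.potential f)))
    (hgrowth : ∃ C : ℝ, ∀ ξ ∈ Ξ, |net.potential f ξ| ≤ C * (1 + ‖ξ‖))
    {t κ : ℝ} {s : Fin N → ℝ} (hp : (f, t, κ, s) ∈ net.sipFeasible α lam Ξ ξs) :
    net.droObjective α lam (wassersteinBall Ξ (empirical ξs) ρ) f ≤
      (net.sipObjective α lam ρ (f, t, κ, s) : ℝ) := by
  refine iSup₂_le fun Q hQ => EReal.coe_le_coe_iff.2 ?_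
  have := hQ.1
  obtain ⟨C, hC⟩ := hgrowth
  have hY := integrable_of_mem_wassersteinBall hΞ hN hQ hmeas hC
  have h1 := integral_le_of_mem_wassersteinBall hN hρ hξs hQ
    (integrable_hingePayoff (α := α) (lam := lam) hY t) hp.1.2 (s := s)
    fun ξ hξ i => sub_nonpos.1 (hp.2 ξ hξ i)
  have h2 := meanCVaR_le hα0 hlamα hα hY t
  simp only [sipObjective]
  linarith

theorem dualBound_le_sipObjective {t κ : ℝ} {s : Fin N → ℝ}
    (hp : (f, t, κ, s) ∈ net.sipFeasible α lam Ξ ξs) :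
    net.dualBound α lam ρ Ξ ξs f ≤ (net.sipObjective α lam ρ (f, t, κ, s) : ℝ) := by
  refine (iInf_le_of_le t (iInf_le_of_le κ (iInf_le _ hp.1.2))).trans ?_
  rw [sipObjective, EReal.coe_add (_ + _), EReal.coe_mul (1 / _)]
  refine add_le_add le_rfl (mul_le_mul_of_nonneg_left ?_ (EReal.coe_nonneg.2 (by positivity)))
  simp only [EReal.coe_finset_sum]
  refine Finset.sum_le_sum fun i _ => iSup₂_le fun ξ hξ => EReal.coe_le_coe_iff.2 ?_
  exact sub_nonpos.1 (hp.2 ξ hξ i)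

/-- At a fixed `(t, κ)`, either some supremum is `⊤` and the bound is trivial, or all are finite and
serve as epigraph variables `s`. Nonemptiness of `Ξ` excludes `⊥`. -/
theorem le_dualBound (hN : 0 < N) (hΞ : Ξ.Nonempty) (hf : f ∈ net.feasible) {v : EReal}
    (hv : ∀ (t κ : ℝ) (s : Fin N → ℝ), (f, t, κ, s) ∈ net.sipFeasible α lam Ξ ξs →
      v ≤ (net.sipObjective α lam ρ (f, t, κ, s) : ℝ)) :
    v ≤ net.dualBound α lam ρ Ξ ξs f := by
  refine le_iInf fun t => le_iInf fun κ => le_iInf fun hκ => ?_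
  obtain ⟨ξ₀, hξ₀⟩ := hΞ
  set S : Fin N → EReal := fun i =>
    ⨆ ξ ∈ Ξ, ((net.payoff α lam t f ξ - κ * ‖ξ - ξs i‖ : ℝ) : EReal) with hS
  have hle : ∀ i, ∀ ξ ∈ Ξ, ((net.payoff α lam t f ξ - κ * ‖ξ - ξs i‖ : ℝ) : EReal) ≤ S i :=
    fun i ξ hξ => le_iSup₂ (f := fun ξ (_ : ξ ∈ Ξ) =>
      ((net.payoff α lam t f ξ - κ * ‖ξ - ξs i‖ : ℝ) : EReal)) ξ hξ
  have hbot : ∀ i, S i ≠ ⊥ := fun i h => by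
    have := hle i ξ₀ hξ₀
    rw [h, le_bot_iff] at this
    exact EReal.coe_ne_bot _ this
  have hN' : (0 : ℝ) < 1 / (N : ℝ) := one_div_pos.2 (by exact_mod_cast hN)
  by_cases htop : ∃ j, S j = ⊤
  · obtain ⟨j, hj⟩ := htop
    rw [EReal.finset_sum_eq_top (fun i _ => hbot i) (Finset.mem_univ j) hj,
      EReal.coe_mul_top_of_pos hN', EReal.coe_add_top]
    exact le_top
  · push Not at htop
    have hs : ∀ i, ∃ x : ℝ, (x : EReal) = S i := fun i =>
      ⟨(S i).toReal, EReal.coe_toReal (htop i) (hbot i)⟩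
    choose s hs using hs
    simp only [← hs] at hle ⊢
    refine (hv t κ s ⟨⟨hf, hκ⟩, fun ξ hξ i =>
      sub_nonpos.2 (EReal.coe_le_coe_iff.1 (hle i ξ hξ))⟩).trans (le_of_eq ?_)
    rw [sipObjective, EReal.coe_add (_ + _), EReal.coe_mul (1 / _), EReal.coe_finset_sum]

/-- The attained dual solution lies below the inf-sup; the interchange turns this into a sup-inf,
whose inner infimum is the mean-CVaR value. -/
theorem exists_sipFeasible_le_droObjective (hΞ : IsClosed Ξ) (hN : 0 < N) (hξs : ∀ i, ξs i ∈ Ξ)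
    (hρ : 0 < ρ) (hlam : 0 ≤ lam) (hlamα : lam ≤ α) (hα : α < 1) (hf : f ∈ net.feasible)
    (hmeas : Measurable (Ξ.domRestrict (net.potential f)))
    (hgrowth : ∃ C : ℝ, ∀ ξ ∈ Ξ, |net.potential f ξ| ≤ C * (1 + ‖ξ‖))
    (hmm : net.MinimaxInterchange α lam (wassersteinBall Ξ (empirical ξs) ρ) f) :
    ∃ (t κ : ℝ) (s : Fin N → ℝ), (f, t, κ, s) ∈ net.sipFeasible α lam Ξ ξs ∧
      ((net.sipObjective α lam ρ (f, t, κ, s) : ℝ) : EReal) ≤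
        net.droObjective α lam (wassersteinBall Ξ (empirical ξs) ρ) f := by
  obtain ⟨t, κ, s, hκ, hs, hle⟩ :=
    exists_robust_dual_solution hΞ hN hξs hρ hlam hlamα hα hmeas hgrowth
  refine ⟨t, κ, s, ⟨⟨hf, hκ⟩, fun ξ hξ i => sub_nonpos.2 (hs ξ hξ i)⟩,
    (hle.trans hmm.symm.le).trans (iSup₂_mono fun Q hQ => ?_)⟩
  have := hQ.1
  obtain ⟨C, hC⟩ := hgrowth
  exact iInf_le_meanCVaR (hlam.trans hlamα) hlamα hα
    (integrable_of_mem_wassersteinBall hΞ hN hQ hmeas hC)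

end Reformulation

end TrafficNetwork

theorem mainTheorem2 {A W : Type*} {K : W → Type*} [Fintype A] [Fintype W]
    [∀ w, Fintype (K w)] {m N : ℕ} (net : TrafficNetwork A W K m)
    (Ξ : Set (EuclideanSpace ℝ (Fin m))) (hΞ : IsClosed Ξ)
    (hN : 0 < N) (ξs : Fin N → EuclideanSpace ℝ (Fin m)) (hξs : ∀ i, ξs i ∈ Ξ)
    (ρ : ℝ) (hρ : 0 < ρ) (α lam : ℝ) (hlam : 0 ≤ lam) (hlamα : lam ≤ α) (hα : α < 1)
    -- link travel times do not decrease in the link flow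
    (hmono : ∀ a, ∀ ξ ∈ Ξ, MonotoneOn (fun ω => net.travelTime a ω ξ) (Set.Ici 0))
    -- the potential is measurable, upper semicontinuous and of linear growth on `Ξ`
    (hmeas : ∀ f ∈ net.feasible, Measurable (Ξ.domRestrict (net.potential f)))
    (husc : ∀ f ∈ net.feasible, UpperSemicontinuousOn (net.potential f) Ξ)
    (hgrowth : ∀ f ∈ net.feasible, ∃ C : ℝ, ∀ ξ ∈ Ξ, |net.potential f ξ| ≤ C * (1 + ‖ξ‖)) :
    -- the expectations exist, and the dual bound holds
    (∀ f ∈ net.feasible,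
      (∀ Q ∈ wassersteinBall Ξ (empirical ξs) ρ, Integrable (net.potential f) Q) ∧
      net.droObjective α lam (wassersteinBall Ξ (empirical ξs) ρ) f ≤
        net.dualBound α lam ρ Ξ ξs f) ∧
    -- tightness, and its form with epigraph variables
    (∀ f ∈ net.feasible,
      net.MinimaxInterchange α lam (wassersteinBall Ξ (empirical ξs) ρ) f →
      (∀ t : ℝ, PiecewiseConcaveOn Ξ (net.payoff α lam t f)) →
      net.droObjective α lam (wassersteinBall Ξ (empirical ξs) ρ) f =
        net.dualBound α lam ρ Ξ ξs f ∧
      net.droObjective α lam (wassersteinBall Ξ (empirical ξs) ρ) f =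
        ⨅ (t : ℝ) (κ : ℝ) (s : Fin N → ℝ) (_ : (f, t, κ, s) ∈ net.sipFeasible α lam Ξ ξs),
          ((net.sipObjective α lam ρ (f, t, κ, s) : ℝ) : EReal)) ∧
    -- the semi-infinite program is convex
    (Convex ℝ (net.sipDomain N) ∧
      ConvexOn ℝ (net.sipDomain N) (net.sipObjective (N := N) α lam ρ) ∧
      (∀ ξ ∈ Ξ, ∀ i, ConvexOn ℝ (net.sipDomain N) (net.sipConstraint α lam ξs ξ i)) ∧
      Convex ℝ (net.sipFeasible α lam Ξ ξs)) ∧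
    -- the semi-infinite program is an exact reformulation of the robust problem
    ((∀ f ∈ net.feasible,
        net.MinimaxInterchange α lam (wassersteinBall Ξ (empirical ξs) ρ) f ∧
        ∀ t : ℝ, PiecewiseConcaveOn Ξ (net.payoff α lam t f)) →
      (⨅ f ∈ net.feasible, net.droObjective α lam (wassersteinBall Ξ (empirical ξs) ρ) f) =
        (⨅ p ∈ net.sipFeasible α lam Ξ ξs, ((net.sipObjective α lam ρ p : ℝ) : EReal)) ∧
      ∀ f : ∀ w, K w → ℝ,
        (f ∈ net.feasible ∧
          IsMinOn (net.droObjective α lam (wassersteinBall Ξ (empirical ξs) ρ))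
            net.feasible f) ↔
        ∃ (t κ : ℝ) (s : Fin N → ℝ), (f, t, κ, s) ∈ net.sipFeasible α lam Ξ ξs ∧
          IsMinOn (net.sipObjective α lam ρ) (net.sipFeasible α lam Ξ ξs) (f, t, κ, s)) := by
  have hα0 : 0 ≤ α := hlam.trans hlamα
  have hne : Ξ.Nonempty := ⟨_, hξs ⟨0, hN⟩⟩
  set D := wassersteinBall Ξ (empirical ξs) ρ with hD
  have hweak : ∀ (f : ∀ w, K w → ℝ) (t κ : ℝ) (s : Fin N → ℝ),
      (f, t, κ, s) ∈ net.sipFeasible α lam Ξ ξs →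
      net.droObjective α lam D f ≤ (net.sipObjective α lam ρ (f, t, κ, s) : ℝ) :=
    fun f t κ s hp => net.droObjective_le_sipObjective hΞ hN hξs hρ.le hα0 hlamα hα
      (hmeas f hp.1.1) (hgrowth f hp.1.1) hp
  have hbound : ∀ f ∈ net.feasible,
      net.droObjective α lam D f ≤ net.dualBound α lam ρ Ξ ξs f := fun f hf =>
    net.le_dualBound hN hne hf (hweak f)
  -- With `hweak`, the point found here attains the robust value at `f`; the rest of the
  -- reformulation is order-theoretic.
  have hstrong : ∀ f ∈ net.feasible, net.MinimaxInterchange α lam D f →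
      ∃ (t κ : ℝ) (s : Fin N → ℝ), (f, t, κ, s) ∈ net.sipFeasible α lam Ξ ξs ∧
        ((net.sipObjective α lam ρ (f, t, κ, s) : ℝ) : EReal) ≤ net.droObjective α lam D f :=
    fun f hf hmm => net.exists_sipFeasible_le_droObjective hΞ hN hξs hρ hlam hlamα hα hf
      (hmeas f hf) (hgrowth f hf) hmm
  refine ⟨fun f hf => ⟨fun Q hQ => ?_, hbound f hf⟩, fun f hf hmm _ => ?_,
    ⟨net.convex_sipDomain N, net.convexOn_sipObjective α lam ρ N,
      fun ξ hξ i => net.convexOn_sipConstraint hlamα hα ξs (fun a => hmono a ξ hξ) i,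
      net.convex_sipFeasible hlamα hα ξs hmono⟩, fun hall => ⟨?_, fun f => ⟨?_, ?_⟩⟩⟩
  · obtain ⟨C, hC⟩ := hgrowth f hf
    exact integrable_of_mem_wassersteinBall hΞ hN hQ (hmeas f hf) hC
  · obtain ⟨t, κ, s, hp, hle⟩ := hstrong f hf hmm
    refine ⟨le_antisymm (hbound f hf) ((net.dualBound_le_sipObjective hp).trans hle),
      le_antisymm (le_iInf fun t => le_iInf fun κ => le_iInf fun s => le_iInf (hweak f t κ s)) ?_⟩
    exact (iInf_le_of_le t (iInf_le_of_le κ (iInf_le_of_le s (iInf_le _ hp)))).trans hle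
  · refine le_antisymm (le_iInf₂ fun p hp => ?_) (le_iInf₂ fun f hf => ?_)
    · exact (iInf₂_le p.1 hp.1.1).trans (hweak p.1 p.2.1 p.2.2.1 p.2.2.2 hp)
    · obtain ⟨t, κ, s, hp, hle⟩ := hstrong f hf (hall f hf).1
      exact (iInf₂_le (f, t, κ, s) hp).trans hle
  -- An infimum over `(t, κ, s)` would not suffice here: the optimal point of the program is the
  -- attained one.
  · rintro ⟨hf, hmin⟩
    obtain ⟨t, κ, s, hp, hle⟩ := hstrong f hf (hall f hf).1
    exact ⟨t, κ, s, hp, fun p hq => EReal.coe_le_coe_iff.1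
      ((hle.trans (hmin hq.1.1)).trans (hweak p.1 p.2.1 p.2.2.1 p.2.2.2 hq))⟩
  · rintro ⟨t, κ, s, hp, hmin⟩
    refine ⟨hp.1.1, fun g hg => ?_⟩
    obtain ⟨t', κ', s', hq, hle⟩ := hstrong g hg (hall g hg).1
    exact ((hweak f t κ s hp).trans (EReal.coe_le_coe_iff.2 (hmin hq))).trans hle
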